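/- Let $k\ge 0$, let $(I,\mathscr I,\nu)$ be a probability space and let $\{T_i\}_{i\in I}$ be a family of maximal monotone operators $T_i:\mathbb R^k\to\mathcal P(\mathbb R^k)$; that is, $\langle x'-x,v'-v\rangle\ge 0$ whenever $v\in T_i(x)$ and $v'\in T_i(x')$, and the graph of $T_i$ is not properly contained in the graph of another monotone operator. Fix $\lambda>0$ and $\alpha\in(0,2)$, let $J_{\lambda T_i}=(\mathrm{Id}+\lambda T_i)^{-1}:\mathbb R^k\to\mathbb R^k$ be the (single-valued, everywhere defined) resolvent, and assume that $i\mapsto J_{\lambda T_i}(x)$ is measurable for every $x\in\mathbb R^k$. Let $(\xi_n)_{n\ge 0}$ be an ergodic stationary sequence of $I$-valued random variables with distribution $\nu$ on a probability space $(\Omega,\mathscr F,\mathbb P)$; that is, the law of $(\xi_n)_{n\ge0}$ on $I^{\mathbb N}$ is invariant and ergodic for the shift. Suppose that $$Z=\{x\in\mathbb R^k : 0\in T_i(x)\text{ for }\nu\text{-almost every } i\}$$ is non-empty. Then for every $x_0\in\mathbb R^k$ the functions $X_n:\Omega\to\mathbb R^k$ defined by $$X_0=x_0,\qquad X_{n+1}=X_n+\alpha\bigl(J_{\lambda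 T_{\xi_n}}(X_n)-X_n\bigr),\quad n\ge 0,$$ are random variables, and $(X_n)$ converges almost surely to a random variable $X$ with values in $Z$. -/

import Mathlib

open MeasureTheory Filter Topology

section Operators

variable {E : Type*} [NormedAddCommGroup E] [InnerProductSpace ℝ E]

/-- The graph of a set-valued operator `T`. -/
def opGraph (T : E → Set E) : Set (E × E) := {p | p.2 ∈ T p.1}

/-- The inverse of a set-valued operator: `x ∈ T⁻¹ v` if and only if `v ∈ T x`. -/
def opInverse (T : E → Set E) : E → Set E := fun v => {x | v ∈ T x}

/-- A set-valued operator is monotone if `⟪x' - x, v' - v⟫ ≥ 0` for all pairs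
`(x, v)`, `(x', v')` in its graph. -/
def IsMonotoneOp (T : E → Set E) : Prop :=
  ∀ p ∈ opGraph T, ∀ q ∈ opGraph T, 0 ≤ inner ℝ (q.1 - p.1) (q.2 - p.2)

/-- A monotone operator is maximal if its graph is not properly contained in the graph of
another monotone operator. -/
def IsMaximalMonotoneOp (T : E → Set E) : Prop :=
  IsMonotoneOp T ∧ ∀ S : E → Set E, IsMonotoneOp S → ¬ opGraph T ⊂ opGraph S

/-- The set-valued operator `Id + lam T`. -/
def idAddSMulOp (lam : ℝ) (T : E → Set E) : E → Set E :=
  fun x => {u | ∃ v ∈ T x, u = x + lam • v}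

/-- The resolvent `J_{lam T} = (Id + lam T)⁻¹` as a map: `resolventMap lam T u` is the element of
`(Id + lam T)⁻¹ u`. For `T` maximal monotone and `lam > 0` on `ℝᵏ` this set is always a singleton. -/
noncomputable def resolventMap (lam : ℝ) (T : E → Set E) (u : E) : E :=
  Classical.epsilon fun x => x ∈ opInverse (idAddSMulOp lam T) u

/-- The points `x` with `0 ∈ T i x` for `ν`-almost every `i`. -/
def aeCommonZeros {I : Type*} [MeasurableSpace I] (ν : Measure I) (T : I → E → Set E) : Set E :=
  {x | ∀ᵐ i ∂ν, (0 : E) ∈ T i x}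

end Operators

/-- The one-sided shift on sequences. -/
def seqShift {I : Type*} (w : ℕ → I) : ℕ → I := fun n => w (n + 1)

/-- `ξ` is an ergodic stationary sequence of random variables on `(Ω, P)`: the law of the whole
sequence on the product space `ℕ → I` is invariant and ergodic for the shift. -/
structure IsErgodicStationary {Ω I : Type*} [MeasurableSpace Ω] [MeasurableSpace I]
    (ξ : ℕ → Ω → I) (P : Measure Ω) : Prop where
  measurable : ∀ n, Measurable (ξ n)
  ergodic : Ergodic (seqShift (I := I)) (P.map fun ω n => ξ n ω)

/-! ### Recurrence for ergodic maps and for the shift. -/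

section Ergodicity

/-! The relaxed resolvents `R i` are nonexpansive, their fixed points are the zeros of `T i`, and a
point that `R i` moves comes strictly closer to every fixed point of `R i`. Hence, almost surely,
the distance from `X n` to each point of Z never increases, and it suffices that the distance to Z
tends to 0: the sequence is then Cauchy, with limit in the closed set Z.

By recurrence of the shift, almost surely every point off Z is moved by some map of the sequence
(`ae_forall_fixed_imp_mem`), so its orbit approaches Z strictly. On a compact set away from Z,
compactness yields one time N and one gain 1/(N+1) valid for all starting points
(`exists_uniform_decrease`). N depends on the sequence, but some fixed N works with positive
probability, hence for infinitely many shifts of almost every sequence. An orbit staying away from Z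
would collect this gain infinitely often, which is impossible.

That resolvents are defined everywhere is Minty's theorem, obtained by a minimax argument for finite
families followed by compactness. -/

/-- Almost every orbit of an ergodic map visits a set of positive measure infinitely often. -/
theorem Ergodic.ae_frequently_iterate_mem {S : Type*} [MeasurableSpace S] {μ : Measure S}
    [IsProbabilityMeasure μ] {f : S → S} (hf : Ergodic f μ) {s : Set S} (hs : MeasurableSet s)
    (hμ : μ s ≠ 0) : ∀ᵐ x ∂μ, ∃ᶠ n in atTop, f^[n] x ∈ s := by
  set t : Set S := {x | ∃ᶠ n in atTop, f^[n] x ∈ s} with ht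
  have htm : MeasurableSet t := by
    have : t = limsup (fun n => f^[n] ⁻¹' s) atTop := by
      ext x
      simp [ht, mem_limsup_iff_frequently_mem]
    rw [this]
    exact MeasurableSet.measurableSet_limsup fun n => (hf.measurable.iterate n) hs
  have hinv : f ⁻¹' t = t := by
    ext x
    have h := frequently_map (m := fun n : ℕ => n + 1) (f := atTop) (P := fun n => f^[n] x ∈ s)
    rw [map_add_atTop_eq_nat] at h
    simpa [ht, Function.iterate_succ_apply] using h.symm
  rcases hf.toPreErgodic.ae_mem_or_ae_notMem htm hinv with h | h
  · exact h
  · exfalso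
    apply hμ
    -- Poincaré recurrence excludes the alternative that `t` is null: almost every point of `s` lies
    -- in `t`, so `s` would be null too.
    have h1 := hf.toMeasurePreserving.conservative.ae_mem_imp_frequently_image_mem
      hs.nullMeasurableSet
    refine measure_mono_null ?_ (ae_iff.1 (h.and h1))
    exact fun x hx hn => hn.1 (hn.2 hx)

theorem seqShift_iterate {I : Type*} (m n : ℕ) (w : ℕ → I) : seqShift^[m] w n = w (n + m) := by
  induction m generalizing w with
  | zero => rfl
  | succ m ih => rw [Function.iterate_succ_apply, ih]; simp [seqShift, Nat.add_assoc]

/-- A property that holds for almost every value of the first coordinate holds for all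
coordinates of almost every sequence. -/
theorem ae_forall_coord_of_ae {I : Type*} [MeasurableSpace I] {μ : Measure (ℕ → I)}
    (hμ : MeasurePreserving (seqShift (I := I)) μ μ) {p : I → Prop}
    (hp : ∀ᵐ i ∂(μ.map fun w => w 0), p i) : ∀ᵐ w ∂μ, ∀ n, p (w n) := by
  rw [ae_all_iff]
  intro n
  have h0 : ∀ᵐ w ∂μ, p (w 0) := ae_of_ae_map (measurable_pi_apply 0).aemeasurable hp
  have := (hμ.iterate n).quasiMeasurePreserving.ae h0
  filter_upwards [this] with w hw
  simpa [seqShift_iterate] using hw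

end Ergodicity

/-! ### Convergence of random compositions of nonexpansive maps. -/

section RandomOrbit

variable {I E : Type*}

/-- The orbit of a point under the composition of the maps `R (w 0), R (w 1), …`. -/
def randomOrbit (R : I → E → E) (w : ℕ → I) : ℕ → E → E
  | 0 => id
  | n + 1 => fun x => R (w n) (randomOrbit R w n x)

theorem randomOrbit_add (R : I → E → E) (w : ℕ → I) (m n : ℕ) (x : E) :
    randomOrbit R w (n + m) x = randomOrbit R (seqShift^[m] w) n (randomOrbit R w m x) := by
  induction n with
  | zero => simp [randomOrbit]
  | succ n ih =>
    rw [Nat.succ_add]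
    simp only [randomOrbit, ih, seqShift_iterate]

theorem randomOrbit_of_forall_fixed {R : I → E → E} {w : ℕ → I} {x : E} (m : ℕ)
    (h : ∀ n < m, R (w n) x = x) : randomOrbit R w m x = x := by
  induction m with
  | zero => rfl
  | succ m ih =>
    simp only [randomOrbit]
    rw [ih fun n hn => h n (by omega), h m (by omega)]

theorem measurable_randomOrbit [MeasurableSpace I] [MeasurableSpace E] {R : I → E → E}
    (hR : Measurable (Function.uncurry R)) (n : ℕ) (x : E) :
    Measurable fun w => randomOrbit R w n x := by
  induction n with
  | zero => exact measurable_const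
  | succ n ih => exact hR.comp ((measurable_pi_apply n).prodMk ih)

variable [MetricSpace E]

theorem lipschitzWith_randomOrbit {R : I → E → E} (hR : ∀ i, LipschitzWith 1 (R i))
    (w : ℕ → I) (n : ℕ) : LipschitzWith 1 (randomOrbit R w n) := by
  induction n with
  | zero => exact LipschitzWith.id
  | succ n ih =>
    have h := (hR (w n)).comp ih
    rwa [one_mul] at h

/-- The points fixed by `R i` for almost every `i`. -/
def aeFixedPoints [MeasurableSpace I] (ν : Measure I) (R : I → E → E) : Set E :=
  {x | ∀ᵐ i ∂ν, R i x = x}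

theorem isClosed_aeFixedPoints [MeasurableSpace I] (ν : Measure I) {R : I → E → E}
    (hR : ∀ i, LipschitzWith 1 (R i)) : IsClosed (aeFixedPoints ν R) := by
  refine IsSeqClosed.isClosed fun u x hu hx => ?_
  filter_upwards [ae_all_iff.2 hu] with i hi
  exact tendsto_nhds_unique (((hR i).continuous.tendsto x).comp hx)
    (hx.congr fun n => (hi n).symm)

/-- In `aeFixedPoints` the exceptional null set depends on the point. A countable dense subset and
closedness of each fixed-point set give a single null set for all points. -/
theorem ae_forall_mem_aeFixedPoints [SecondCountableTopology E] [MeasurableSpace I]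
    (ν : Measure I) {R : I → E → E}
    (hR : ∀ i, LipschitzWith 1 (R i)) : ∀ᵐ i ∂ν, ∀ z ∈ aeFixedPoints ν R, R i z = z := by
  obtain ⟨c, hcZ, hc, hd⟩ := (TopologicalSpace.IsSeparable.of_separableSpace (aeFixedPoints ν R)).exists_countable_dense_subset
  filter_upwards [(ae_ball_iff hc).2 fun z hz => hcZ hz] with i hi z hz
  have hcl : IsClosed {z | R i z = z} := isClosed_eq (hR i).continuous continuous_id
  exact closure_minimal (fun z hz => hi z hz) hcl (hd hz)

/-- Almost surely, a point that is fixed by all maps along the sequence is fixed by almost all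
maps. -/
theorem ae_forall_fixed_imp_mem [SecondCountableTopology E] [MeasurableSpace I]
    [MeasurableSpace E] [BorelSpace E] {μ : Measure (ℕ → I)} [IsProbabilityMeasure μ]
    (hμ : Ergodic (seqShift (I := I)) μ) {R : I → E → E} (hRm : ∀ x, Measurable fun i => R i x)
    (hR : ∀ i, LipschitzWith 1 (R i)) :
    ∀ᵐ w ∂μ, ∀ x, (∀ n, R (w n) x = x) → x ∈ aeFixedPoints (μ.map fun w => w 0) R := by
  set Z := aeFixedPoints (μ.map fun w => w 0) R with hZ
  have key : ∀ x ∈ Zᶜ, ∃ η > 0, ∀ᵐ w ∂μ, ∀ y ∈ Metric.ball x η, ∃ n, R (w n) y ≠ y := by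
    intro x hx
    have hx' : μ {w | R (w 0) x ≠ x} ≠ 0 := by
      intro h
      apply hx
      have hm : MeasurableSet {i | R i x = x} := (hRm x) (measurableSet_singleton x)
      exact (ae_map_iff (measurable_pi_apply 0).aemeasurable hm).2 h
    -- The factor 2 leaves room for the ball: if a map fixes some y within η of x, nonexpansiveness
    -- moves x by less than 2η.
    have hU : {w : ℕ → I | R (w 0) x ≠ x} ⊆
        ⋃ k : ℕ, {w | 2 * (1 / ((k : ℝ) + 1)) < dist (R (w 0) x) x} := by
      intro w hw
      have hpos : 0 < dist (R (w 0) x) x / 2 := by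
        have := dist_pos.2 hw
        positivity
      obtain ⟨k, hk⟩ := exists_nat_one_div_lt hpos
      exact Set.mem_iUnion.2 ⟨k, by simp only [Set.mem_ofPred_eq]; linarith⟩
    obtain ⟨k, hk⟩ : ∃ k : ℕ, μ {w | 2 * (1 / ((k : ℝ) + 1)) < dist (R (w 0) x) x} ≠ 0 := by
      by_contra! hcon
      exact hx' (measure_mono_null hU (measure_iUnion_null hcon))
    have hm : MeasurableSet {w : ℕ → I | 2 * (1 / ((k : ℝ) + 1)) < dist (R (w 0) x) x} :=
      measurableSet_lt measurable_const
        (((hRm x).comp (measurable_pi_apply 0)).dist measurable_const)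
    refine ⟨1 / ((k : ℝ) + 1), by positivity, ?_⟩
    filter_upwards [hμ.ae_frequently_iterate_mem hm hk] with w hw y hy
    obtain ⟨n, hn⟩ := hw.exists
    refine ⟨n, fun hfix => ?_⟩
    simp only [seqShift_iterate, zero_add] at hn
    have h1 := (hR (w n)).dist_le_mul x y
    rw [hfix] at h1
    have h2 := dist_triangle (R (w n) x) y x
    rw [Metric.mem_ball] at hy
    rw [dist_comm x y] at h1
    simp only [NNReal.coe_one, one_mul] at h1
    linarith
  choose! η hη hkey using key
  -- Lindelöf: countably many such balls cover the complement of Z, so the null sets can be united.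
  obtain ⟨t, htZ, htc, hcov⟩ := TopologicalSpace.countable_cover_nhdsWithin
    (f := fun x => Metric.ball x (η x)) (s := Zᶜ)
    fun x hx => mem_nhdsWithin_of_mem_nhds (Metric.ball_mem_nhds x (hη x hx))
  filter_upwards [(ae_ball_iff htc).2 fun x hx => hkey x (htZ hx)] with w hw x hx
  by_contra hxZ
  obtain ⟨y, hy, hxy⟩ := Set.mem_iUnion₂.1 (hcov hxZ)
  obtain ⟨n, hn⟩ := hw y hy x hxy
  exact hn (hx n)

theorem dist_randomOrbit_antitone {R : I → E → E} (hR : ∀ i, LipschitzWith 1 (R i))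
    {w : ℕ → I} {z : E} (hz : ∀ n, R (w n) z = z) (x : E) :
    Antitone fun n => dist (randomOrbit R w n x) z := by
  refine antitone_nat_of_succ_le fun n => ?_
  have := (hR (w n)).dist_le_mul (randomOrbit R w n x) z
  rw [hz n] at this
  simpa [randomOrbit] using this

theorem infDist_randomOrbit_antitone {R : I → E → E} (hR : ∀ i, LipschitzWith 1 (R i))
    {w : ℕ → I} {Z : Set E} (hZ : Z.Nonempty) (hz : ∀ n, ∀ z ∈ Z, R (w n) z = z) (x : E) :
    Antitone fun n => Metric.infDist (randomOrbit R w n x) Z := by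
  intro m n hmn
  rw [Metric.le_infDist hZ]
  intro z hzZ
  exact (Metric.infDist_le_dist_of_mem hzZ).trans
    (dist_randomOrbit_antitone hR (fun n => hz n z hzZ) x hmn)

/-- If not all maps along the sequence fix `x`, then the orbit of `x` comes strictly closer to
the set of common fixed points. -/
theorem exists_infDist_randomOrbit_lt [ProperSpace E] {R : I → E → E}
    (hstrict : ∀ i x z, R i z = z → R i x ≠ x → dist (R i x) z < dist x z)
    {w : ℕ → I} {Z : Set E} (hZc : IsClosed Z) (hZ : Z.Nonempty)
    (hz : ∀ n, ∀ z ∈ Z, R (w n) z = z) {x : E} (hx : ∃ n, R (w n) x ≠ x) :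
    ∃ n, Metric.infDist (randomOrbit R w n x) Z < Metric.infDist x Z := by
  classical
  obtain ⟨p, hp, hdist⟩ := hZc.exists_infDist_eq_dist hZ x
  -- The orbit rests at x until the first map that moves x; that map brings it strictly closer to
  -- the nearest point p of Z.
  refine ⟨Nat.find hx + 1, ?_⟩
  have h1 : randomOrbit R w (Nat.find hx) x = x :=
    randomOrbit_of_forall_fixed _ fun n hn => not_not.1 (Nat.find_min hx hn)
  rw [hdist]
  simp only [randomOrbit, h1]
  exact (Metric.infDist_le_dist_of_mem hp).trans_lt
    (hstrict _ _ _ (hz _ p hp) (Nat.find_spec hx))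

/-- On a compact set disjoint from the common fixed points the orbits come uniformly closer to the
set of common fixed points. -/
theorem exists_uniform_decrease {R : I → E → E} (hR : ∀ i, LipschitzWith 1 (R i)) {w : ℕ → I}
    {Z K : Set E} (hK : IsCompact K) (hZ : Z.Nonempty) (hz : ∀ n, ∀ z ∈ Z, R (w n) z = z)
    (hdec : ∀ x ∈ K, ∃ n, Metric.infDist (randomOrbit R w n x) Z < Metric.infDist x Z) :
    ∃ N : ℕ, ∀ x ∈ K,
      Metric.infDist (randomOrbit R w N x) Z + 1 / ((N : ℝ) + 1) ≤ Metric.infDist x Z := by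
  -- Time and gain share the parameter N, so the open sets `U N` increase and compactness selects a
  -- single N.
  let U : ℕ → Set E := fun N =>
    {x | Metric.infDist (randomOrbit R w N x) Z + 1 / ((N : ℝ) + 1) < Metric.infDist x Z}
  have hmono : Monotone U := by
    intro m n hmn x hx
    have h1 := infDist_randomOrbit_antitone hR hZ hz x hmn
    have h2 : 1 / ((n : ℝ) + 1) ≤ 1 / ((m : ℝ) + 1) := Nat.one_div_le_one_div hmn
    simp only [U, Set.mem_ofPred_eq] at hx ⊢
    simp only at h1
    linarith
  have hopen : ∀ N, IsOpen (U N) := fun N =>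
    isOpen_lt (((Metric.continuous_infDist_pt Z).comp
      (lipschitzWith_randomOrbit hR w N).continuous).add continuous_const)
      (Metric.continuous_infDist_pt Z)
  have hcov : K ⊆ ⋃ N, U N := by
    intro x hx
    obtain ⟨n, hn⟩ := hdec x hx
    obtain ⟨k, hk⟩ := exists_nat_one_div_lt (sub_pos.2 hn)
    refine Set.mem_iUnion.2 ⟨max n k, ?_⟩
    have h1 := infDist_randomOrbit_antitone hR hZ hz x (le_max_left n k)
    have h2 : 1 / (((max n k : ℕ) : ℝ) + 1) ≤ 1 / ((k : ℝ) + 1) :=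
      Nat.one_div_le_one_div (le_max_right n k)
    simp only [U, Set.mem_ofPred_eq]
    simp only at h1
    linarith
  obtain ⟨N, hN⟩ := hK.elim_directed_cover U hopen hcov hmono.directed_le
  exact ⟨N, fun x hx => (hN hx).le⟩

/-- Both sides are continuous in x, so the condition need only be tested on a countable dense subset
of K. -/
theorem measurableSet_uniform_decrease [SecondCountableTopology E] [MeasurableSpace I]
    [MeasurableSpace E] [BorelSpace E] {R : I → E → E}
    (hRm : Measurable (Function.uncurry R)) (hR : ∀ i, LipschitzWith 1 (R i)) (Z K : Set E)
    (N : ℕ) : MeasurableSet {w : ℕ → I | ∀ x ∈ K,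
      Metric.infDist (randomOrbit R w N x) Z + 1 / ((N : ℝ) + 1) ≤ Metric.infDist x Z} := by
  obtain ⟨c, hcK, hc, hd⟩ := (TopologicalSpace.IsSeparable.of_separableSpace K).exists_countable_dense_subset
  have heq : {w : ℕ → I | ∀ x ∈ K,
      Metric.infDist (randomOrbit R w N x) Z + 1 / ((N : ℝ) + 1) ≤ Metric.infDist x Z} =
      ⋂ x ∈ c, {w : ℕ → I |
        Metric.infDist (randomOrbit R w N x) Z + 1 / ((N : ℝ) + 1) ≤ Metric.infDist x Z} := by
    ext w
    simp only [Set.mem_ofPred_eq, Set.mem_iInter]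
    refine ⟨fun h x hx => h x (hcK hx), fun h x hx => ?_⟩
    have hcl : IsClosed {x | Metric.infDist (randomOrbit R w N x) Z + 1 / ((N : ℝ) + 1)
        ≤ Metric.infDist x Z} :=
      isClosed_le (((Metric.continuous_infDist_pt Z).comp
        (lipschitzWith_randomOrbit hR w N).continuous).add continuous_const)
        (Metric.continuous_infDist_pt Z)
    exact closure_minimal h hcl (hd hx)
  rw [heq]
  exact MeasurableSet.biInter hc fun x _ => measurableSet_le
    (((Metric.continuous_infDist_pt Z).measurable.comp
      (measurable_randomOrbit hRm N x)).add measurable_const) measurable_const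

/-- Ergodic compositions of nonexpansive maps that strictly decrease the distance to their fixed
points converge to a common fixed point. -/
theorem ae_exists_tendsto_randomOrbit [ProperSpace E] [MeasurableSpace I]
    [MeasurableSpace E] [BorelSpace E] {μ : Measure (ℕ → I)} [IsProbabilityMeasure μ]
    (hμ : Ergodic (seqShift (I := I)) μ) {R : I → E → E}
    (hRm : Measurable (Function.uncurry R)) (hR : ∀ i, LipschitzWith 1 (R i))
    (hstrict : ∀ i x z, R i z = z → R i x ≠ x → dist (R i x) z < dist x z)
    (hZ : (aeFixedPoints (μ.map fun w => w 0) R).Nonempty) (x₀ : E) :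
    ∀ᵐ w ∂μ, ∃ x ∈ aeFixedPoints (μ.map fun w => w 0) R,
      Tendsto (fun n => randomOrbit R w n x₀) atTop (𝓝 x) := by
  have hZc : IsClosed (aeFixedPoints (μ.map fun w => w 0) R) := isClosed_aeFixedPoints _ hR
  have hfix := ae_forall_coord_of_ae hμ.toMeasurePreserving
    (ae_forall_mem_aeFixedPoints (μ.map fun w => w 0) hR)
  have hmem := ae_forall_fixed_imp_mem hμ (fun x => hRm.of_uncurry_right) hR
  set Z := aeFixedPoints (μ.map fun w => w 0) R
  obtain ⟨z₀, hz₀⟩ := hZ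
  -- The orbit of `x₀` never leaves this ball, so it lies in `K m` as long as its distance to Z is
  -- at least 1/(m+1).
  let K : ℕ → Set E := fun m =>
    Metric.closedBall z₀ (dist x₀ z₀) ∩ {x | 1 / ((m : ℝ) + 1) ≤ Metric.infDist x Z}
  have hK : ∀ m, IsCompact (K m) := fun m =>
    (isCompact_closedBall _ _).inter_right
      (isClosed_le continuous_const (Metric.continuous_infDist_pt Z))
  let A : ℕ → ℕ → Set (ℕ → I) := fun m N => {w | ∀ x ∈ K m,
      Metric.infDist (randomOrbit R w N x) Z + 1 / ((N : ℝ) + 1) ≤ Metric.infDist x Z}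
  have hA : ∀ m, ∃ N, μ (A m N) ≠ 0 := by
    intro m
    by_contra! hcon
    have hnull : ∀ᵐ w ∂μ, ∀ N, w ∉ A m N :=
      ae_all_iff.2 fun N => measure_eq_zero_iff_ae_notMem.1 (hcon N)
    have hfalse : ∀ᵐ w ∂μ, False := by
      filter_upwards [hnull, hfix, hmem] with w h1 h2 h3
      obtain ⟨N, hN⟩ := exists_uniform_decrease hR (hK m) ⟨z₀, hz₀⟩ h2 fun x hx =>
        exists_infDist_randomOrbit_lt hstrict hZc ⟨z₀, hz₀⟩ h2 (by
          by_contra! hall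
          have h0 : Metric.infDist x Z = 0 := Metric.infDist_zero_of_mem (h3 x hall)
          have h4 := hx.2
          simp only [Set.mem_ofPred_eq, h0] at h4
          have h5 : 0 < 1 / ((m : ℝ) + 1) := Nat.one_div_pos_of_nat
          linarith)
      exact h1 N hN
    simp only [ae_iff, not_false_eq_true, Set.ofPred_true, measure_univ, one_ne_zero] at hfalse
  choose N hN using hA
  have hvisit : ∀ᵐ w ∂μ, ∀ m, ∃ᶠ n in atTop, seqShift^[n] w ∈ A m (N m) :=
    ae_all_iff.2 fun m => hμ.ae_frequently_iterate_mem
      (measurableSet_uniform_decrease hRm hR Z (K m) (N m)) (hN m)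
  filter_upwards [hvisit, hfix] with w hv hw
  have hanti := infDist_randomOrbit_antitone hR ⟨z₀, hz₀⟩ hw x₀
  have hsmall : ∀ m : ℕ, ∃ n, Metric.infDist (randomOrbit R w n x₀) Z < 1 / ((m : ℝ) + 1) := by
    intro m
    by_contra! hcon
    -- Each visit to `A m (N m)` is chosen after the previous block of `N m` steps has ended, so the
    -- gains add up.
    have hdrop : ∀ j : ℕ, ∃ n, Metric.infDist (randomOrbit R w n x₀) Z
        + j * (1 / ((N m : ℝ) + 1)) ≤ Metric.infDist x₀ Z := by
      intro j
      induction j with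
      | zero => exact ⟨0, by simp [randomOrbit]⟩
      | succ j ih =>
        obtain ⟨n, hn⟩ := ih
        obtain ⟨l, hl, hlA⟩ := frequently_atTop.1 (hv m) n
        have hball : randomOrbit R w l x₀ ∈ K m :=
          ⟨dist_randomOrbit_antitone hR (fun n => hw n z₀ hz₀) x₀ (Nat.zero_le l), hcon l⟩
        have h1 := hlA _ hball
        rw [← randomOrbit_add] at h1
        have h2 := hanti hl
        simp only at h2
        refine ⟨N m + l, ?_⟩
        push_cast
        linarith
    obtain ⟨j, hj⟩ := exists_nat_gt (Metric.infDist x₀ Z * ((N m : ℝ) + 1))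
    obtain ⟨n, hn⟩ := hdrop j
    have h1 : 0 ≤ Metric.infDist (randomOrbit R w n x₀) Z := Metric.infDist_nonneg
    have h2 : (j : ℝ) * (1 / ((N m : ℝ) + 1)) ≤ Metric.infDist x₀ Z := by linarith
    rw [mul_one_div, div_le_iff₀ (by positivity)] at h2
    linarith
  have hsmall' : ∀ ε > 0, ∃ n, Metric.infDist (randomOrbit R w n x₀) Z < ε := by
    intro ε hε
    obtain ⟨m, hm⟩ := exists_nat_one_div_lt hε
    obtain ⟨n, hn⟩ := hsmall m
    exact ⟨n, hn.trans hm⟩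
  have hcauchy : CauchySeq fun n => randomOrbit R w n x₀ := by
    rw [Metric.cauchySeq_iff']
    intro ε hε
    obtain ⟨n, hn⟩ := hsmall' (ε / 2) (by positivity)
    obtain ⟨p, hp, hpd⟩ := (Metric.infDist_lt_iff ⟨z₀, hz₀⟩).1 hn
    refine ⟨n, fun l hl => ?_⟩
    have h1 := dist_randomOrbit_antitone hR (fun n => hw n p hp) x₀ hl
    simp only at h1
    have h2 := dist_triangle_right (randomOrbit R w l x₀) (randomOrbit R w n x₀) p
    linarith
  obtain ⟨x, hx⟩ := cauchySeq_tendsto_of_complete hcauchy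
  refine ⟨x, ?_, hx⟩
  have hlim := ((Metric.continuous_infDist_pt Z).tendsto x).comp hx
  rw [hZc.mem_iff_infDist_zero ⟨z₀, hz₀⟩]
  refine le_antisymm (le_of_forall_pos_le_add fun ε hε => ?_) Metric.infDist_nonneg
  obtain ⟨n, hn⟩ := hsmall' ε hε
  have h1 := hanti.le_of_tendsto hlim n
  linarith

end RandomOrbit

/-! ### Minty's theorem for maximal monotone operators. -/

section Minty

variable {E : Type*} [NormedAddCommGroup E] [InnerProductSpace ℝ E]

/-- For a finite monotone family `(y i, v i)`, averages satisfy
`⟪∑ a i y i, ∑ a i v i⟫ ≤ ∑ a i ⟪y i, v i⟫`. -/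
theorem inner_sum_le_sum_inner_of_monotone {ι : Type*} [Fintype ι] {y v : ι → E}
    (hmono : ∀ i j, 0 ≤ inner ℝ (y j - y i) (v j - v i)) {a : ι → ℝ}
    (ha : a ∈ stdSimplex ℝ ι) :
    inner ℝ (∑ i, a i • y i) (∑ i, a i • v i) ≤ ∑ i, a i * inner ℝ (y i) (v i) := by
  -- The monotonicity inequalities averaged with weights `a i * a j`; the sum is twice the
  -- difference of the two sides.
  have h : 0 ≤ ∑ i, ∑ j, a i * a j * inner ℝ (y j - y i) (v j - v i) :=
    Finset.sum_nonneg fun i _ => Finset.sum_nonneg fun j _ =>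
      mul_nonneg (mul_nonneg (ha.1 i) (ha.1 j)) (hmono i j)
  have e : ∑ i, ∑ j, a i * a j * inner ℝ (y j - y i) (v j - v i)
      = 2 * ((∑ i, a i) * ∑ i, a i * inner ℝ (y i) (v i))
        - 2 * inner ℝ (∑ i, a i • y i) (∑ i, a i • v i) := by
    have e1 : (inner ℝ (∑ i, a i • y i) (∑ i, a i • v i) : ℝ)
        = ∑ i, ∑ j, a i * a j * inner ℝ (y i) (v j) := by
      simp only [sum_inner, inner_sum, inner_smul_left, inner_smul_right, RCLike.conj_to_real,
        Finset.mul_sum, mul_assoc]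
      rw [Finset.sum_comm]
      exact Finset.sum_congr rfl fun i _ => Finset.sum_congr rfl fun j _ => by ring
    have e2 : ∑ i, ∑ j, a i * a j * inner ℝ (y j) (v i)
        = ∑ i, ∑ j, a i * a j * (inner ℝ (y i) (v j) : ℝ) := by
      rw [Finset.sum_comm]
      exact Finset.sum_congr rfl fun i _ => Finset.sum_congr rfl fun j _ => by ring
    have e3 : ∑ i, ∑ j, a i * a j * (inner ℝ (y j) (v j) : ℝ)
        = (∑ i, a i) * ∑ i, a i * inner ℝ (y i) (v i) := by
      rw [Finset.sum_mul_sum]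
      exact Finset.sum_congr rfl fun i _ => Finset.sum_congr rfl fun j _ => by ring
    have e4 : ∑ i, ∑ j, a i * a j * (inner ℝ (y i) (v i) : ℝ)
        = (∑ i, a i) * ∑ i, a i * inner ℝ (y i) (v i) := by
      rw [← e3, Finset.sum_comm]
      exact Finset.sum_congr rfl fun i _ => Finset.sum_congr rfl fun j _ => by ring
    rw [e1]
    simp only [inner_sub_left, inner_sub_right, mul_sub, Finset.sum_sub_distrib, e2, e3, e4]
    ring
  rw [e, ha.2] at h
  linarith

/-- Every finite monotone family `(y i, v i)` is monotonically related to some pair `(x, -x)`. -/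
theorem exists_forall_inner_nonneg_of_finite {ι : Type*} [Fintype ι] [Nonempty ι] {y v : ι → E}
    (hmono : ∀ i j, 0 ≤ inner ℝ (y j - y i) (v j - v i)) :
    ∃ x : E, ∀ i, inner ℝ (x - y i) (x + v i) ≤ 0 := by
  classical
  let c : ι → E := fun i => y i - v i
  let bary : (ι → ℝ) → E := fun a => ∑ i, a i • c i
  -- Dual function: with φ_i(x) = ⟪x - y i, x + v i⟫ = ‖x‖² - ⟪x, c i⟫ - ⟪y i, v i⟫, the value `D a`
  -- is the minimum over x of ∑ a i φ_i(x), attained at half of `bary a`.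
  let D : (ι → ℝ) → ℝ := fun a =>
    -∑ i, a i * inner ℝ (y i) (v i) - ‖bary a‖ ^ 2 / 4
  have hbc : Continuous bary := by fun_prop
  have hDc : Continuous D := by fun_prop
  obtain ⟨a, ha, hmax⟩ := (isCompact_stdSimplex ℝ ι).exists_isMaxOn
    ⟨_, single_mem_stdSimplex ℝ (Classical.arbitrary ι)⟩ hDc.continuousOn
  have hDle : D a ≤ 0 := by
    have h1 := inner_sum_le_sum_inner_of_monotone hmono ha
    have h2 : bary a = ∑ i, a i • y i - ∑ i, a i • v i := by
      simp only [bary, c, smul_sub, Finset.sum_sub_distrib]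
    set p := ∑ i, a i • y i
    set q := ∑ i, a i • v i
    have h3 : ‖p - q‖ ^ 2 = ‖p‖ ^ 2 - 2 * inner ℝ p q + ‖q‖ ^ 2 := norm_sub_sq_real p q
    have h4 : ‖p + q‖ ^ 2 = ‖p‖ ^ 2 + 2 * inner ℝ p q + ‖q‖ ^ 2 := norm_add_sq_real p q
    have h5 := sq_nonneg ‖p + q‖
    simp only [D, h2]
    linarith
  refine ⟨(1 / 2 : ℝ) • bary a, fun j => ?_⟩
  set b := bary a with hb
  have hφ : (inner ℝ ((1 / 2 : ℝ) • b - y j) ((1 / 2 : ℝ) • b + v j) : ℝ)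
      = ‖b‖ ^ 2 / 4 - inner ℝ b (c j) / 2 - inner ℝ (y j) (v j) := by
    simp only [c, inner_sub_left, inner_add_right, inner_sub_right, inner_smul_left,
      inner_smul_right, RCLike.conj_to_real, real_inner_self_eq_norm_sq]
    rw [real_inner_comm b (y j)]
    ring
  -- Optimality of a towards the vertex j, divided by t; as t → 0 it gives φ_j(b/2) ≤ `D a` ≤ 0.
  have hvar : ∀ t ∈ Set.Ioc (0 : ℝ) 1,
      ‖b‖ ^ 2 / 4 - inner ℝ b (c j) / 2 - inner ℝ (y j) (v j) - D a ≤ t * (‖c j - b‖ ^ 2 / 4) := by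
    intro t ht
    let a' : ι → ℝ := (1 - t) • a + t • Pi.single j 1
    have ha' : a' ∈ stdSimplex ℝ ι :=
      (convex_stdSimplex ℝ ι) ha (single_mem_stdSimplex ℝ j) (by linarith [ht.2]) ht.1.le (by ring)
    have h1 : D a' ≤ D a := hmax ha'
    have h2 : bary a' = b + t • (c j - b) := by
      have : bary a' = (1 - t) • b + t • c j := by
        simp only [a', bary, hb, Pi.add_apply, Pi.smul_apply, smul_eq_mul, add_smul,
          Finset.sum_add_distrib, mul_smul, ← Finset.smul_sum]
        simp [Pi.single_apply, ite_smul]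
      rw [this]
      module
    have h3 : ∑ i, a' i * (inner ℝ (y i) (v i) : ℝ)
        = (1 - t) * ∑ i, a i * inner ℝ (y i) (v i) + t * inner ℝ (y j) (v j) := by
      simp only [a', Pi.add_apply, Pi.smul_apply, smul_eq_mul, add_mul, Finset.sum_add_distrib,
        mul_assoc, ← Finset.mul_sum]
      simp [Pi.single_apply]
    have h4 : ‖b + t • (c j - b)‖ ^ 2
        = ‖b‖ ^ 2 + 2 * (t * (inner ℝ b (c j) - ‖b‖ ^ 2)) + t ^ 2 * ‖c j - b‖ ^ 2 := by
      rw [norm_add_sq_real, inner_smul_right, inner_sub_right, real_inner_self_eq_norm_sq,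
        norm_smul, mul_pow, Real.norm_eq_abs, sq_abs]
    have h5 : D a' = -((1 - t) * ∑ i, a i * inner ℝ (y i) (v i) + t * inner ℝ (y j) (v j))
        - (‖b‖ ^ 2 + 2 * (t * (inner ℝ b (c j) - ‖b‖ ^ 2)) + t ^ 2 * ‖c j - b‖ ^ 2) / 4 := by
      simp only [D, h2, h3, h4]
    have h6 : D a = -∑ i, a i * inner ℝ (y i) (v i) - ‖b‖ ^ 2 / 4 := rfl
    refine le_of_mul_le_mul_left ?_ ht.1
    rw [h5] at h1
    rw [h6] at h1 ⊢
    nlinarith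
  have hlim : ‖b‖ ^ 2 / 4 - inner ℝ b (c j) / 2 - inner ℝ (y j) (v j) - D a ≤ 0 := by
    have ht : Tendsto (fun t : ℝ => t * (‖c j - b‖ ^ 2 / 4)) (𝓝[>] 0) (𝓝 0) := by
      have : Tendsto (fun t : ℝ => t * (‖c j - b‖ ^ 2 / 4)) (𝓝 0) (𝓝 (0 * (‖c j - b‖ ^ 2 / 4))) :=
        (continuous_id.mul continuous_const).tendsto 0
      rw [zero_mul] at this
      exact this.mono_left nhdsWithin_le_nhds
    refine ge_of_tendsto ht ?_
    filter_upwards [Ioc_mem_nhdsGT (zero_lt_one (α := ℝ))] with t h using hvar t h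
  rw [hφ]
  linarith

/-- Every monotone set of pairs is monotonically related to some pair `(x, u - x)`. -/
theorem exists_forall_inner_nonneg_of_monotone [ProperSpace E] {G : Set (E × E)}
    (hG : ∀ p ∈ G, ∀ q ∈ G, 0 ≤ inner ℝ (q.1 - p.1) (q.2 - p.2)) (u : E) :
    ∃ x : E, ∀ p ∈ G, 0 ≤ inner ℝ (x - p.1) (u - x - p.2) := by
  classical
  rcases G.eq_empty_or_nonempty with rfl | ⟨p₀, hp₀⟩
  · exact ⟨0, by simp⟩
  let B : G → Set E := fun p => {x | 0 ≤ inner ℝ (x - p.1.1) (u - x - p.1.2)}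
  have hclosed : ∀ p, IsClosed (B p) := fun p => isClosed_le continuous_const (by fun_prop)
  -- Membership gives ‖x - p.1‖² ≤ ⟪x - p.1, u - p.1 - p.2⟫, and Cauchy–Schwarz bounds x.
  -- Compactness then reduces the claim to finite subfamilies.
  have hbdd : ∀ p, Bornology.IsBounded (B p) := by
    intro p
    rw [Metric.isBounded_iff_subset_closedBall p.1.1]
    refine ⟨‖u - p.1.1 - p.1.2‖, fun x hx => ?_⟩
    simp only [B, Set.mem_ofPred_eq] at hx
    rw [Metric.mem_closedBall, dist_eq_norm]
    have h1 : u - x - p.1.2 = (u - p.1.1 - p.1.2) - (x - p.1.1) := by abel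
    rw [h1, inner_sub_right, real_inner_self_eq_norm_sq] at hx
    have h2 := real_inner_le_norm (x - p.1.1) (u - p.1.1 - p.1.2)
    by_contra! hlt
    have h3 : 0 ≤ ‖u - p.1.1 - p.1.2‖ := norm_nonneg _
    nlinarith
  have hfin : ∀ s : Finset G, (B ⟨p₀, hp₀⟩ ∩ ⋂ p ∈ s, B p).Nonempty := by
    intro s
    let s' := insert ⟨p₀, hp₀⟩ s
    have : Nonempty s' := ⟨⟨_, Finset.mem_insert_self _ _⟩⟩
    obtain ⟨x, hx⟩ := exists_forall_inner_nonneg_of_finite (ι := s')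
      (y := fun p => p.1.1.1) (v := fun p => p.1.1.2 - u) (fun i j => by
        simpa using hG _ i.1.2 _ j.1.2)
    have hx' : ∀ p ∈ s', x ∈ B p := by
      intro p hp
      have h := hx ⟨p, hp⟩
      have e : u - x - p.1.2 = -(x + (p.1.2 - u)) := by abel
      simp only [B, Set.mem_ofPred_eq, e, inner_neg_right]
      simp only at h
      linarith
    exact ⟨x, hx' _ (Finset.mem_insert_self _ _), Set.mem_iInter₂.2 fun p hp =>
      hx' p (Finset.mem_insert_of_mem hp)⟩
  obtain ⟨x, -, hx⟩ := (Metric.isCompact_of_isClosed_isBounded (hclosed ⟨p₀, hp₀⟩)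
    (hbdd _)).inter_iInter_nonempty B hclosed hfin
  exact ⟨x, fun p hp => Set.mem_iInter.1 hx ⟨p, hp⟩⟩

/-- A pair that is monotonically related to a maximal monotone operator lies in its graph. -/
theorem IsMaximalMonotoneOp.mem_of_forall_inner_nonneg {T : E → Set E}
    (hT : IsMaximalMonotoneOp T) {x v : E}
    (h : ∀ p ∈ opGraph T, 0 ≤ inner ℝ (x - p.1) (v - p.2)) : v ∈ T x := by
  by_contra hv
  let S : E → Set E := fun y => {w | w ∈ T y ∨ (y = x ∧ w = v)}
  refine hT.2 S ?_ ⟨fun p hp => Or.inl hp, fun hsub => hv (hsub (a := (x, v)) (Or.inr ⟨rfl, rfl⟩))⟩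
  rintro ⟨p1, p2⟩ hp ⟨q1, q2⟩ hq
  rcases hp with hp | ⟨hp1, hp2⟩ <;> rcases hq with hq | ⟨hq1, hq2⟩
  · exact hT.1 _ hp _ hq
  · simp only at hq1 hq2
    subst hq1 hq2
    exact h _ hp
  · simp only at hp1 hp2
    subst hp1 hp2
    have := h _ hq
    rw [← neg_sub q1, ← neg_sub q2, inner_neg_neg] at this
    exact this
  · simp only at hp1 hp2 hq1 hq2
    subst hp1 hp2 hq1 hq2
    simp

/-- **Minty's theorem**: `Id + lam T` is surjective. -/
theorem IsMaximalMonotoneOp.exists_mem_opInverse [ProperSpace E] {T : E → Set E}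
    (hT : IsMaximalMonotoneOp T) {lam : ℝ} (hlam : 0 < lam) (u : E) :
    ∃ x, x ∈ opInverse (idAddSMulOp lam T) u := by
  obtain ⟨x, hx⟩ := exists_forall_inner_nonneg_of_monotone
    (G := (fun p : E × E => (p.1, lam • p.2)) '' opGraph T) (by
      rintro _ ⟨p, hp, rfl⟩ _ ⟨q, hq, rfl⟩
      simp only [← smul_sub, inner_smul_right]
      exact mul_nonneg hlam.le (hT.1 p hp q hq)) u
  refine ⟨x, lam⁻¹ • (u - x), hT.mem_of_forall_inner_nonneg fun p hp => ?_, ?_⟩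
  · have h := hx _ ⟨p, hp, rfl⟩
    have e : lam⁻¹ • (u - x) - p.2 = lam⁻¹ • (u - x - lam • p.2) := by
      rw [smul_sub lam⁻¹ (u - x), inv_smul_smul₀ hlam.ne']
    rw [e, inner_smul_right]
    exact mul_nonneg (inv_nonneg.2 hlam.le) h
  · rw [smul_inv_smul₀ hlam.ne']
    abel

/-! ### Resolvents and their relaxations. -/

theorem IsMaximalMonotoneOp.resolventMap_spec [ProperSpace E] {T : E → Set E}
    (hT : IsMaximalMonotoneOp T) {lam : ℝ} (hlam : 0 < lam) (u : E) :
    ∃ v ∈ T (resolventMap lam T u), u = resolventMap lam T u + lam • v :=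
  Classical.epsilon_spec (hT.exists_mem_opInverse hlam u)

/-- The resolvent is firmly nonexpansive. -/
theorem IsMaximalMonotoneOp.resolventMap_firmly_nonexpansive [ProperSpace E] {T : E → Set E}
    (hT : IsMaximalMonotoneOp T) {lam : ℝ} (hlam : 0 < lam) (u u' : E) :
    0 ≤ inner ℝ (resolventMap lam T u - resolventMap lam T u')
      ((u - u') - (resolventMap lam T u - resolventMap lam T u')) := by
  obtain ⟨v, hv, hu⟩ := hT.resolventMap_spec hlam u
  obtain ⟨v', hv', hu'⟩ := hT.resolventMap_spec hlam u'
  set x := resolventMap lam T u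
  set x' := resolventMap lam T u'
  have e : (u - u') - (x - x') = lam • (v - v') := by rw [hu, hu']; module
  rw [e, inner_smul_right]
  exact mul_nonneg hlam.le (hT.1 (x', v') hv' (x, v) hv)

theorem IsMaximalMonotoneOp.resolventMap_eq_self_iff [ProperSpace E] {T : E → Set E}
    (hT : IsMaximalMonotoneOp T) {lam : ℝ} (hlam : 0 < lam) (x : E) :
    resolventMap lam T x = x ↔ (0 : E) ∈ T x := by
  constructor
  · intro h
    obtain ⟨v, hv, hu⟩ := hT.resolventMap_spec hlam x
    rw [h] at hv hu
    have : v = 0 := by simpa [hlam.ne'] using hu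
    exact this ▸ hv
  · intro h
    obtain ⟨v, hv, hu⟩ := hT.resolventMap_spec hlam x
    set z := resolventMap lam T x
    -- Since z - x = -lam v, monotonicity reads -lam ‖v‖² ≥ 0, which forces v = 0.
    have h1 := hT.1 (x, 0) h (z, v) hv
    have e : z - x = -(lam • v) := by rw [hu]; abel_nf
    simp only [e, sub_zero, inner_neg_left, inner_smul_left, RCLike.conj_to_real,
      real_inner_self_eq_norm_sq] at h1
    have h2 : ‖v‖ = 0 := by
      by_contra hne
      have : 0 < lam * ‖v‖ ^ 2 := by positivity
      linarith
    rw [hu, norm_eq_zero.1 h2]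
    simp

/-- The relaxed resolvent `Id + α (J - Id)`. -/
noncomputable def relaxedResolvent (lam α : ℝ) (T : E → Set E) (x : E) : E :=
  x + α • (resolventMap lam T x - x)

theorem relaxedResolvent_eq_self_iff {lam α : ℝ} (hα : α ≠ 0) {T : E → Set E} {x : E} :
    relaxedResolvent lam α T x = x ↔ resolventMap lam T x = x := by
  simp [relaxedResolvent, hα, sub_eq_zero]

/-- With d = x - y and j the difference of resolvents, firm nonexpansiveness gives ⟪d, d - j⟫ ≥ ‖d -
j‖²; insert this in the expansion of ‖d - α(d - j)‖². For 0 < α < 2 the surplus term yields both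
nonexpansiveness and the strict decrease towards fixed points. -/
theorem IsMaximalMonotoneOp.relaxedResolvent_averaged [ProperSpace E] {T : E → Set E}
    (hT : IsMaximalMonotoneOp T) {lam α : ℝ} (hlam : 0 < lam) (hα : 0 < α) (x y : E) :
    ‖relaxedResolvent lam α T x - relaxedResolvent lam α T y‖ ^ 2
      + α * (2 - α) * ‖(x - y) - (resolventMap lam T x - resolventMap lam T y)‖ ^ 2
      ≤ ‖x - y‖ ^ 2 := by
  have h := hT.resolventMap_firmly_nonexpansive hlam x y
  have e : relaxedResolvent lam α T x - relaxedResolvent lam α T y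
      = (x - y) - α • ((x - y) - (resolventMap lam T x - resolventMap lam T y)) := by
    simp only [relaxedResolvent]
    module
  rw [e]
  set j := resolventMap lam T x - resolventMap lam T y
  set d := x - y
  have h1 : (inner ℝ d (d - j) : ℝ) = inner ℝ j (d - j) + ‖d - j‖ ^ 2 := by
    rw [← real_inner_self_eq_norm_sq, ← inner_add_left]
    congr 1
    abel
  rw [norm_sub_sq_real, inner_smul_right, norm_smul, mul_pow, Real.norm_eq_abs, sq_abs, h1]
  have := mul_nonneg hα.le h
  linarith

theorem IsMaximalMonotoneOp.lipschitzWith_relaxedResolvent [ProperSpace E] {T : E → Set E}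
    (hT : IsMaximalMonotoneOp T) {lam α : ℝ} (hlam : 0 < lam) (hα : α ∈ Set.Ioo (0 : ℝ) 2) :
    LipschitzWith 1 (relaxedResolvent lam α T) := by
  refine LipschitzWith.of_dist_le_mul fun x y => ?_
  rw [NNReal.coe_one, one_mul, dist_eq_norm, dist_eq_norm]
  have h := hT.relaxedResolvent_averaged hlam hα.1 x y
  have h1 : 0 ≤ α * (2 - α) * ‖(x - y) - (resolventMap lam T x - resolventMap lam T y)‖ ^ 2 :=
    mul_nonneg (mul_nonneg hα.1.le (by linarith [hα.2])) (sq_nonneg _)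
  exact le_of_sq_le_sq (by linarith) (norm_nonneg _)

theorem IsMaximalMonotoneOp.dist_relaxedResolvent_lt [ProperSpace E] {T : E → Set E}
    (hT : IsMaximalMonotoneOp T) {lam α : ℝ} (hlam : 0 < lam) (hα : α ∈ Set.Ioo (0 : ℝ) 2)
    {x z : E} (hz : relaxedResolvent lam α T z = z) (hx : relaxedResolvent lam α T x ≠ x) :
    dist (relaxedResolvent lam α T x) z < dist x z := by
  have h := hT.relaxedResolvent_averaged hlam hα.1 x z
  rw [hz, (relaxedResolvent_eq_self_iff hα.1.ne').1 hz] at h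
  rw [Ne, relaxedResolvent_eq_self_iff hα.1.ne'] at hx
  have e : (x - z) - (resolventMap lam T x - z) = x - resolventMap lam T x := by abel
  have h1 : 0 < ‖x - resolventMap lam T x‖ := norm_pos_iff.2 (sub_ne_zero.2 (Ne.symm hx))
  have h2 : 0 < α * (2 - α) * ‖x - resolventMap lam T x‖ ^ 2 :=
    mul_pos (mul_pos hα.1 (by linarith [hα.2])) (by positivity)
  rw [e] at h
  rw [dist_eq_norm, dist_eq_norm]
  exact lt_of_pow_lt_pow_left₀ 2 (norm_nonneg _) (by linarith)

end Minty

/-! ### Application to the relaxed resolvent iteration. -/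

theorem aeFixedPoints_relaxedResolvent {I E : Type*} [NormedAddCommGroup E]
    [InnerProductSpace ℝ E] [ProperSpace E] [MeasurableSpace I] (ν : Measure I)
    {T : I → E → Set E} (hT : ∀ i, IsMaximalMonotoneOp (T i)) {lam α : ℝ} (hlam : 0 < lam)
    (hα : α ≠ 0) :
    aeFixedPoints ν (fun i => relaxedResolvent lam α (T i)) = aeCommonZeros ν T := by
  ext x
  simp only [aeFixedPoints, aeCommonZeros, Set.mem_ofPred_eq]
  refine eventually_congr (Eventually.of_forall fun i => ?_)
  rw [relaxedResolvent_eq_self_iff hα, (hT i).resolventMap_eq_self_iff hlam]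

theorem mainTheorem3 {k : ℕ}
    {I : Type*} [MeasurableSpace I] (ν : Measure I) [IsProbabilityMeasure ν]
    {Ω : Type*} [MeasurableSpace Ω] (P : Measure Ω) [IsProbabilityMeasure P]
    (T : I → EuclideanSpace ℝ (Fin k) → Set (EuclideanSpace ℝ (Fin k)))
    (hT : ∀ i, IsMaximalMonotoneOp (T i))
    (lam : ℝ) (hlam : 0 < lam) (α : ℝ) (hα : α ∈ Set.Ioo (0 : ℝ) 2)
    (hmeas : ∀ x, Measurable fun i => resolventMap lam (T i) x)
    (ξ : ℕ → Ω → I) (hξ : IsErgodicStationary ξ P) (hν : P.map (ξ 0) = ν)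
    (hZ : (aeCommonZeros ν T).Nonempty)
    (x₀ : EuclideanSpace ℝ (Fin k))
    (X : ℕ → Ω → EuclideanSpace ℝ (Fin k))
    (hX0 : ∀ ω, X 0 ω = x₀)
    (hX : ∀ n ω, X (n + 1) ω
      = X n ω + α • (resolventMap lam (T (ξ n ω)) (X n ω) - X n ω)) :
    (∀ n, Measurable (X n)) ∧
      ∃ Xlim : Ω → EuclideanSpace ℝ (Fin k),
        Measurable Xlim ∧ (∀ ω, Xlim ω ∈ aeCommonZeros ν T) ∧
          ∀ᵐ ω ∂P, Tendsto (fun n => X n ω) atTop (𝓝 (Xlim ω)) := by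
  let R : I → EuclideanSpace ℝ (Fin k) → EuclideanSpace ℝ (Fin k) :=
    fun i => relaxedResolvent lam α (T i)
  have hR : ∀ i, LipschitzWith 1 (R i) := fun i => (hT i).lipschitzWith_relaxedResolvent hlam hα
  have hRx : ∀ x, Measurable fun i => R i x := fun x =>
    measurable_const.add (((hmeas x).sub measurable_const).const_smul α)
  -- Carathéodory: measurable in i and continuous in x over a separable space implies jointly
  -- measurable.
  have hRm : Measurable (Function.uncurry R) :=
    (measurable_uncurry_of_continuous_of_measurable (u := fun x i => R i x)
      (fun i => (hR i).continuous) hRx).comp measurable_swap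
  have hξm : Measurable fun ω n => ξ n ω := measurable_pi_lambda _ hξ.measurable
  have : IsProbabilityMeasure (P.map fun ω n => ξ n ω) :=
    Measure.isProbabilityMeasure_map hξm.aemeasurable
  have hmarg : ((P.map fun ω n => ξ n ω).map fun w => w 0) = ν := by
    rw [Measure.map_map (measurable_pi_apply 0) hξm, ← hν]
    rfl
  have hXorbit : ∀ n ω, X n ω = randomOrbit R (fun n => ξ n ω) n x₀ := by
    intro n ω
    induction n with
    | zero => exact hX0 ω
    | succ n ih => rw [hX, ih]; rfl
  have hXm : ∀ n, Measurable (X n) := by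
    intro n
    rw [funext (hXorbit n)]
    exact (measurable_randomOrbit hRm n x₀).comp hξm
  have hfix := aeFixedPoints_relaxedResolvent ν hT hlam hα.1.ne'
  have hconv := ae_exists_tendsto_randomOrbit hξ.ergodic hRm hR
    (fun i x z hz hx => (hT i).dist_relaxedResolvent_lt hlam hα hz hx)
    (by rw [hmarg, hfix]; exact hZ) x₀
  rw [hmarg, hfix] at hconv
  have hlim : ∀ᵐ ω ∂P, ∃ x ∈ aeCommonZeros ν T, Tendsto (fun n => X n ω) atTop (𝓝 x) := by
    filter_upwards [ae_of_ae_map hξm.aemeasurable hconv] with ω hω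
    simpa only [hXorbit] using hω
  have hZm : MeasurableSet (aeCommonZeros ν T) := by
    rw [← hfix]
    exact (isClosed_aeFixedPoints ν hR).measurableSet
  refine ⟨hXm, ?_⟩
  obtain ⟨Y, hYm, hY⟩ := measurable_limit_of_tendsto_metrizable_ae
    (fun n => (hXm n).aemeasurable) (hlim.mono fun ω ⟨x, _, hx⟩ => ⟨x, hx⟩)
  obtain ⟨z₀, hz₀⟩ := hZ
  classical
  -- The measurable limit `Y` is redefined as `z₀` where it misses Z, a null event, so that the
  -- limit takes values in Z everywhere.
  refine ⟨fun ω => if Y ω ∈ aeCommonZeros ν T then Y ω else z₀,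
    Measurable.ite (hYm hZm) hYm measurable_const, fun ω => ?_, ?_⟩
  · dsimp only
    split_ifs with h
    exacts [h, hz₀]
  · filter_upwards [hlim, hY] with ω ⟨x, hxZ, hx⟩ hYω
    rwa [if_pos (tendsto_nhds_unique hx hYω ▸ hxZ)]
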